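/- Let $n,p,M\ge 0$ be integers, let $A_1,\dots,A_M\in\mathbb R^{n\times n}$, $B_1,\dots,B_M\in\mathbb R^{n\times p}$, let $\mathcal M_1,\dots,\mathcal M_M\subseteq\mathbb R^n$ be pairwise disjoint Borel sets (for example polyhedral regions, described by strict and non-strict linear inequalities) with $\bigcup_j\mathcal M_j=\mathbb R^n$, and let $\pi\in\mathbb R^{p\times n}$ be a linear control law $u=\pi x$. Put $\hat A_j=A_j+B_j\pi$ and consider the closed-loop switched linear system $$x_{t+1}=\sum_{j=1}^M\bigl(\hat A_j x_t+w_t^j\bigr)\,\mathbf 1_{\mathcal M_j}(x_t),$$ where every $w_t^j$ is $\mathcal N(0,I_n)$-distributed, the noise families $(w_t^j)_{1\le j\le M}$, $t\ge 0$, are independent, and $x_0$ is independent of the noise. Its transition kernel is $P(x,\cdot)=\sum_j\mathbf 1_{\mathcal M_j}(x)\,\mathcal N(\hat A_jx,I_n)$. Assume that there is $\varrho<\infty$ such that $\|\hat A_k\|_2<1$ (spectral norm) for every $k$ for which $\mathcal M_k$ contains a point $x$ with $\|x\|_2>\varrho$. Then the system mixes geometrically to a unique ergodic invariant distribution. That is,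 there is a probability measure $\nu_\pi$ on $\mathbb R^n$ such that 1. $\nu_\pi P=\nu_\pi$, and $\nu_\pi$ is the only $P$-invariant probability measure; it is ergodic (if $S$ is a Borel set with $P(x,S)=1$ for $\nu_\pi$-almost every $x\in S$, then $\nu_\pi(S)\in\{0,1\}$), and $\int\|x\|_2^2\,\nu_\pi(dx)<\infty$; and there are constants $\beta>0$, $C>0$, $\eta\in(0,1)$ such that 2. for all probability measures $\mu_1,\mu_2$ on $\mathbb R^n$, $\mathcal W_{d_\beta}(\mu_1P,\mu_2P)\le\eta\,\mathcal W_{d_\beta}(\mu_1,\mu_2)$, where $d_\beta(x,y)=(2+\beta\|x\|_2^2+\beta\|y\|_2^2)\,\mathbf 1_{x\ne y}$ and $\mathcal W_{d}(\mu,\nu)\in[0,\infty]$ is the infimum of $\int d\,d\Gamma$ over all couplings $\Gamma$ of $\mu$ and $\nu$; 3. $\|P^t(x,\cdot)-\nu_\pi\|_{tv}\le C\eta^t(1+\|x\|_2^2)$ for all $x\in\mathbb R^n$ and $t\ge0$, where $\|\mu-\nu\|_{tv}=2\sup_S|\mu(S)-\nu(S)|$; 4. for every trajectory $(x_t)$ of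 the system, $\|\mathrm{Law}(x_t)-\nu_\pi\|_{tv}\le C\eta^t(1+\mathbb E\|x_0\|_2^2)$ for all $t\ge0$ (trivially true if $\mathbb E\|x_0\|_2^2=\infty$). -/

import Mathlib

open MeasureTheory ProbabilityTheory
open scoped ENNReal

/-- A switched linear dynamical system on `ℝⁿ` with inputs in `ℝᵖ` and `M` modes:
matrices `A j`, `B j` and a measurable region for each mode, the regions being pairwise disjoint
with union the whole state space. -/
structure SLDS (n p M : ℕ) where
  /-- state matrix of each mode -/
  A : Fin M → Matrix (Fin n) (Fin n) ℝ
  /-- input matrix of each mode -/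
  B : Fin M → Matrix (Fin n) (Fin p) ℝ
  /-- region of the state space in which each mode is active -/
  region : Fin M → Set (EuclideanSpace ℝ (Fin n))
  measurableSet_region : ∀ j, MeasurableSet (region j)
  disjoint_region : ∀ j k, j ≠ k → Disjoint (region j) (region k)
  iUnion_region : (⋃ j, region j) = Set.univ

namespace SLDS

variable {n p M : ℕ}

/-- The closed-loop matrix `A j + B j π` under the linear control law `u = π x`. -/
def closedLoop (S : SLDS n p M) (π : Matrix (Fin p) (Fin n) ℝ) (j : Fin M) :
    Matrix (Fin n) (Fin n) ℝ :=
  S.A j + S.B j * π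

/-- The closed-loop matrix as an operator on Euclidean space; its operator norm is the spectral
norm of the matrix. -/
noncomputable def closedLoopOp (S : SLDS n p M) (π : Matrix (Fin p) (Fin n) ℝ) (j : Fin M) :
    EuclideanSpace ℝ (Fin n) →L[ℝ] EuclideanSpace ℝ (Fin n) :=
  Matrix.toEuclideanCLM (𝕜 := ℝ) (S.closedLoop π j)

/-- `x` is a trajectory of the closed-loop system driven by the noise `w`:
`x (t+1) = ∑ j, (Â j (x t) + w t j) 1_{region j} (x t)`, where each `w t j` is standard Gaussian,
the noise vectors `(w t j)_j` at different times are independent, and the whole noise is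
independent of the initial state. -/
structure IsTrajectory (S : SLDS n p M) (π : Matrix (Fin p) (Fin n) ℝ)
    {Ω : Type*} [MeasurableSpace Ω] (Pr : Measure Ω)
    (w : ℕ → Fin M → Ω → EuclideanSpace ℝ (Fin n)) (x : ℕ → Ω → EuclideanSpace ℝ (Fin n)) :
    Prop where
  measurable_noise : ∀ t j, Measurable (w t j)
  measurable_init : Measurable (x 0)
  law_noise : ∀ t j, Pr.map (w t j) = stdGaussian (EuclideanSpace ℝ (Fin n))
  indep_noise : iIndepFun (fun t ω => fun j => w t j ω) Pr
  indep_init : IndepFun (x 0) (fun ω => fun t j => w t j ω) Pr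
  step : ∀ t ω, x (t + 1) ω =
    ∑ j, (S.region j).indicator (fun y => S.closedLoopOp π j y + w t j ω) (x t ω)

/-- The one-step transition kernel of the closed-loop system:
`P(x, ·) = ∑ j, 1_{region j}(x) N(Â j x, I)`. -/
noncomputable def kernel (S : SLDS n p M) (π : Matrix (Fin p) (Fin n) ℝ) :
    Kernel (EuclideanSpace ℝ (Fin n)) (EuclideanSpace ℝ (Fin n)) where
  toFun x := ∑ j, (S.region j).indicator
    (fun y => (stdGaussian (EuclideanSpace ℝ (Fin n))).map (fun z => S.closedLoopOp π j y + z)) x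
  measurable' := by
    refine Finset.measurable_sum _ fun j _ => Measurable.indicator ?_ (S.measurableSet_region j)
    refine Measure.measurable_of_measurable_coe _ fun s hs => ?_
    have hm : Measurable fun q : EuclideanSpace ℝ (Fin n) × EuclideanSpace ℝ (Fin n) =>
        S.closedLoopOp π j q.1 + q.2 := by fun_prop
    have h := measurable_measure_prodMk_left
      (ν := stdGaussian (EuclideanSpace ℝ (Fin n))) (hm hs)
    convert h using 2 with y
    rw [Measure.map_apply (by fun_prop) hs]
    rfl

end SLDS

/-- The total variation norm `‖μ - ν‖` of the difference of two probability measures, normalized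
to have maximal value `2`. -/
noncomputable def tvNorm {α : Type*} [MeasurableSpace α] (μ ν : Measure α) : ℝ≥0∞ :=
  2 * ⨆ (s : Set α) (_ : MeasurableSet s), ENNReal.ofReal |μ.real s - ν.real s|

/-- The Wasserstein distance for the cost `d`: the infimum of `∫ d` over all couplings. -/
noncomputable def wasserstein {α : Type*} [MeasurableSpace α] (d : α → α → ℝ≥0∞)
    (μ ν : Measure α) : ℝ≥0∞ :=
  ⨅ (Γ : Measure (α × α)) (_ : Γ.fst = μ ∧ Γ.snd = ν), ∫⁻ z, d z.1 z.2 ∂Γ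

open Classical in
/-- The weighted discrete metric `(2 + β V(x) + β V(y)) 1_{x ≠ y}` with `V(x) = ‖x‖²`. -/
noncomputable def weightedMetric {n : ℕ} (β : ℝ) (x y : EuclideanSpace ℝ (Fin n)) : ℝ≥0∞ :=
  if x = y then 0 else ENNReal.ofReal (2 + β * ‖x‖ ^ 2 + β * ‖y‖ ^ 2)

/-- An invariant measure `ν` of the kernel `P` is ergodic if every measurable set `s` that is
invariant, i.e. `P(x, s) = 1` for `ν`-almost every `x ∈ s`, has `ν`-measure `0` or `1`. -/
def IsErgodicInvariant {α : Type*} [MeasurableSpace α] (P : Kernel α α) (ν : Measure α) : Prop :=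
  P.Invariant ν ∧
    ∀ s, MeasurableSet s → (∀ᵐ x ∂ν, x ∈ s → P x s = 1) → ν s = 0 ∨ ν s = 1

/-! This is Harris' theorem in the weighted form of Hairer and Mattingly, with Lyapunov function `V
x = ‖x‖²`. Two facts about the system enter. Drift: modes of norm at least one act only inside a
ball, so `∫ V dP(x,·) ≤ γ V x + K` with `γ < 1` (`exists_drift`). Minorization: bounded states have
bounded one-step means, and unit Gaussians with bounded means dominate a common multiple of one
probability measure (`exists_smul_le_kernel`).

The contraction comes from an explicit coupling of `P(x,·)` and `P(y,·)` (`exists_coupling_kernel`).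
If `V x + V y` is large, the drift alone shrinks the cost. If it is small, the copies meet with
probability at least `α`, which lowers the constant `2`, and a small `β` keeps the weighted part
from undoing the gain. Averaging over couplings of the initial laws gives
`exists_wasserstein_contraction`.

The weighted distance dominates total variation, so the orbit of a Dirac mass is uniformly Cauchy on
measurable sets; its setwise limit is the invariant law (`exists_invariant_of_contraction`).
Uniqueness gives ergodicity by conditioning on an invariant set. Independence of the noise
identifies laws along trajectories with iterates of the kernel (`IsTrajectory.map_eq_bind_pow`). -/

/-! ### Couplings, weighted Wasserstein cost and total variation. -/

section Coupling

open scoped NNReal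

variable {X : Type*}

open Classical in
/-- The discrete metric weighted by a function `V`, `(2 + β V(x) + β V(y)) 1_{x ≠ y}`. -/
noncomputable def weightedDiscrete (V : X → ℝ≥0) (β : ℝ≥0) (x y : X) : ℝ≥0∞ :=
  if x = y then 0 else 2 + β * V x + β * V y

lemma weightedDiscrete_self (V : X → ℝ≥0) (β : ℝ≥0) (x : X) : weightedDiscrete V β x x = 0 := by
  simp [weightedDiscrete]

lemma weightedDiscrete_of_ne (V : X → ℝ≥0) (β : ℝ≥0) {x y : X} (h : x ≠ y) :
    weightedDiscrete V β x y = 2 + β * V x + β * V y := by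
  simp [weightedDiscrete, h]

lemma weightedDiscrete_le (V : X → ℝ≥0) (β : ℝ≥0) (x y : X) :
    weightedDiscrete V β x y ≤ 2 + β * V x + β * V y := by
  unfold weightedDiscrete; split_ifs <;> simp

variable [MeasurableSpace X]

lemma measurable_weightedDiscrete [MeasurableEq X] {V : X → ℝ≥0} (hV : Measurable V) (β : ℝ≥0) :
    Measurable fun z : X × X => weightedDiscrete V β z.1 z.2 := by
  unfold weightedDiscrete
  exact Measurable.ite measurableSet_diagonal measurable_const (by fun_prop)

lemma fst_bind_eq {Γ : Measure (X × X)} {P : Kernel X X} {K : Kernel (X × X) (X × X)}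
    (h : ∀ z, (K z).fst = P z.1) : (Γ.bind K).fst = Γ.fst.bind P := by
  ext s hs
  rw [Measure.fst_apply hs, Measure.bind_apply (measurable_fst hs) K.aemeasurable,
    Measure.bind_apply hs P.aemeasurable, Measure.fst,
    lintegral_map (P.measurable_coe hs) measurable_fst]
  exact lintegral_congr fun z => by rw [← h z, Measure.fst_apply hs]

lemma snd_bind_eq {Γ : Measure (X × X)} {P : Kernel X X} {K : Kernel (X × X) (X × X)}
    (h : ∀ z, (K z).snd = P z.2) : (Γ.bind K).snd = Γ.snd.bind P := by
  ext s hs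
  rw [Measure.snd_apply hs, Measure.bind_apply (measurable_snd hs) K.aemeasurable,
    Measure.bind_apply hs P.aemeasurable, Measure.snd,
    lintegral_map (P.measurable_coe hs) measurable_snd]
  exact lintegral_congr fun z => by rw [← h z, Measure.snd_apply hs]

/-- A measurable family of couplings contracting the cost makes the kernel a contraction for the
Wasserstein distance. -/
lemma wasserstein_bind_le {d : X → X → ℝ≥0∞} (hd : Measurable fun z : X × X => d z.1 z.2)
    {P : Kernel X X} {K : Kernel (X × X) (X × X)} (hfst : ∀ z, (K z).fst = P z.1)
    (hsnd : ∀ z, (K z).snd = P z.2) {η : ℝ≥0∞} (hη0 : η ≠ 0) (hη : η ≠ ∞)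
    (hK : ∀ z, ∫⁻ z', d z'.1 z'.2 ∂(K z) ≤ η * d z.1 z.2) (μ₁ μ₂ : Measure X) :
    wasserstein d (μ₁.bind P) (μ₂.bind P) ≤ η * wasserstein d μ₁ μ₂ := by
  unfold wasserstein
  -- `η ≠ 0` matters when no coupling exists: the infimum is then `∞` and must stay `∞` after
  -- scaling.
  simp_rw [ENNReal.mul_iInf_of_ne hη0 hη]
  refine le_iInf₂ fun Γ hΓ => ?_
  refine (iInf₂_le (Γ.bind K)
    ⟨by rw [fst_bind_eq hfst, hΓ.1], by rw [snd_bind_eq hsnd, hΓ.2]⟩).trans ?_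
  rw [Measure.lintegral_bind K.aemeasurable hd.aemeasurable, ← lintegral_const_mul _ hd]
  exact lintegral_mono hK

lemma lintegral_weightedDiscrete_prod_le {V : X → ℝ≥0} (hV : Measurable V) (β : ℝ≥0)
    (μ ν : Measure X) [IsProbabilityMeasure μ] [IsProbabilityMeasure ν] :
    ∫⁻ z, weightedDiscrete V β z.1 z.2 ∂(μ.prod ν) ≤
      2 + β * ∫⁻ x, V x ∂μ + β * ∫⁻ x, V x ∂ν := by
  refine (lintegral_mono fun z : X × X => weightedDiscrete_le V β z.1 z.2).trans ?_
  rw [lintegral_prod _ (by fun_prop)]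
  simp only
  simp_rw [lintegral_add_left (f := fun _ => _ + _) measurable_const,
    lintegral_const_mul _ hV.coe_nnreal_ennreal]
  simp only [lintegral_const, measure_univ, mul_one]
  rw [lintegral_add_right _ measurable_const, lintegral_add_left measurable_const,
    lintegral_const_mul _ hV.coe_nnreal_ennreal]
  simp

lemma wasserstein_weightedDiscrete_le {V : X → ℝ≥0} (hV : Measurable V) (β : ℝ≥0)
    (μ ν : Measure X) [IsProbabilityMeasure μ] [IsProbabilityMeasure ν] :
    wasserstein (weightedDiscrete V β) μ ν ≤
      2 + β * ∫⁻ x, V x ∂μ + β * ∫⁻ x, V x ∂ν :=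
  (iInf₂_le (μ.prod ν) ⟨by simp, by simp⟩).trans (lintegral_weightedDiscrete_prod_le hV β μ ν)

/-- Under any coupling, the masses of a set differ by at most the probability of being off the
diagonal, where the cost is at least `2`. This `2` matches the normalization of `tvNorm`. -/
lemma tvNorm_le_wasserstein [MeasurableEq X] (V : X → ℝ≥0) (β : ℝ≥0)
    (μ ν : Measure X) [IsProbabilityMeasure μ] [IsProbabilityMeasure ν] :
    tvNorm μ ν ≤ wasserstein (weightedDiscrete V β) μ ν := by
  refine le_iInf₂ fun Γ hΓ => ?_
  obtain ⟨h1, h2⟩ := hΓ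
  have hD : MeasurableSet {z : X × X | z.1 ≠ z.2} := measurableSet_diagonal.compl
  have hle : 2 * Γ {z : X × X | z.1 ≠ z.2} ≤ ∫⁻ z, weightedDiscrete V β z.1 z.2 ∂Γ := by
    rw [← lintegral_indicator_const hD]
    refine lintegral_mono fun z => ?_
    by_cases hz : z.1 = z.2
    · simp [hz]
    · rw [weightedDiscrete_of_ne _ _ hz, add_assoc, Set.indicator_of_mem (by exact hz)]
      exact le_self_add
  refine le_trans ?_ hle
  unfold tvNorm
  gcongr
  refine iSup₂_le fun s hs => ?_
  have key : ∀ a b : Set (X × X), a ⊆ b ∪ {z | z.1 ≠ z.2} → Γ a ≤ Γ b + Γ {z | z.1 ≠ z.2} :=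
    fun a b hab => (measure_mono hab).trans (measure_union_le _ _)
  have hμ : μ s = Γ (Prod.fst ⁻¹' s) := by rw [← h1, Measure.fst_apply hs]
  have hν : ν s = Γ (Prod.snd ⁻¹' s) := by rw [← h2, Measure.snd_apply hs]
  have hfin : Γ {z : X × X | z.1 ≠ z.2} ≠ ∞ := by
    refine ((measure_mono (Set.subset_univ _)).trans_lt ?_).ne
    rw [← Measure.fst_univ, h1]
    simp
  have k1 := key (Prod.fst ⁻¹' s) (Prod.snd ⁻¹' s) (by
    intro z hz
    by_cases h : z.1 = z.2
    · left; simpa [← h] using hz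
    · right; exact h)
  have k2 := key (Prod.snd ⁻¹' s) (Prod.fst ⁻¹' s) (by
    intro z hz
    by_cases h : z.1 = z.2
    · left; simpa [h] using hz
    · right; exact h)
  rw [← hμ, ← hν] at k1 k2
  rw [← ENNReal.ofReal_toReal hfin]
  refine ENNReal.ofReal_le_ofReal (abs_sub_le_iff.2 ⟨?_, ?_⟩)
  · rw [sub_le_iff_le_add', Measure.real, Measure.real, ← ENNReal.toReal_add (by simp) hfin]
    exact ENNReal.toReal_mono (by simp [hfin]) k1
  · rw [sub_le_iff_le_add', Measure.real, Measure.real, ← ENNReal.toReal_add (by simp) hfin]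
    exact ENNReal.toReal_mono (by simp [hfin]) k2

/-- The normalized remainder of a Markov kernel after removing a common minorant on a set. -/
lemma exists_residual_kernel (P : Kernel X X) [IsMarkovKernel P] {G : Set X} (hG : MeasurableSet G)
    {α : ℝ≥0} (hα : α < 1) (ν₀ : Measure X) [IsProbabilityMeasure ν₀]
    (hmin : ∀ x ∈ G, α • ν₀ ≤ P x) :
    ∃ R : Kernel X X, IsMarkovKernel R ∧ ∀ x ∈ G, P x = α • ν₀ + (1 - α) • R x := by
  classical
  have h1 : 1 - α ≠ 0 := (tsub_pos_of_lt hα).ne'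
  -- The value `ν₀` outside `G` is arbitrary; it only keeps the kernel Markov.
  let R : Kernel X X :=
    { toFun := fun x => if x ∈ G then (1 - α)⁻¹ • (P x - α • ν₀) else ν₀
      measurable' := by
        refine Measure.measurable_of_measurable_coe _ fun s hs => ?_
        have : (fun x => (if x ∈ G then (1 - α)⁻¹ • (P x - α • ν₀) else ν₀) s) =
            fun x => if x ∈ G then (1 - α)⁻¹ • (P x s - α • ν₀ s) else ν₀ s := by
          ext x
          split_ifs with hx
          · rw [Measure.smul_apply, Measure.sub_apply hs (hmin x hx), Measure.smul_apply]
          · rfl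
        rw [this]
        refine Measurable.ite hG ?_ measurable_const
        exact ((P.measurable_coe hs).sub measurable_const).const_smul _ }
  have hR : ∀ x ∈ G, R x = (1 - α)⁻¹ • (P x - α • ν₀) := fun x hx => if_pos hx
  have hR' : ∀ x ∉ G, R x = ν₀ := fun x hx => if_neg hx
  refine ⟨R, ⟨fun x => ⟨?_⟩⟩, fun x hx => ?_⟩
  · by_cases hx : x ∈ G
    · rw [hR x hx, Measure.smul_apply, Measure.sub_apply .univ (hmin x hx), Measure.smul_apply,
        measure_univ, measure_univ, ENNReal.smul_def, ENNReal.smul_def, smul_eq_mul, smul_eq_mul,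
        mul_one]
      rw [← ENNReal.coe_one, ← ENNReal.coe_sub, ← ENNReal.coe_mul, inv_mul_cancel₀ h1]
    · rw [hR' x hx, measure_univ]
  · rw [hR x hx, smul_smul, mul_inv_cancel₀ h1, one_smul, add_comm,
      Measure.sub_add_cancel_of_le (hmin x hx)]

end Coupling

/-! ### Harris' contraction from drift and minorization. -/

section Contraction

open scoped NNReal

variable {X : Type*} [MeasurableSpace X]

/-- A measurable coupling of the transition probabilities of a Markov kernel satisfying a local
minorization condition: the two coordinates move together once they agree, and from two points of
the small set they meet with probability at least `α`. -/
lemma exists_coupling_kernel [MeasurableEq X] (P : Kernel X X) [IsMarkovKernel P] {G : Set X}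
    (hG : MeasurableSet G) {α : ℝ≥0} (hα : α < 1) (ν₀ : Measure X) [IsProbabilityMeasure ν₀]
    (hmin : ∀ x ∈ G, α • ν₀ ≤ P x) {V : X → ℝ≥0} (hV : Measurable V) (β : ℝ≥0) :
    ∃ K : Kernel (X × X) (X × X),
      (∀ z, (K z).fst = P z.1) ∧ (∀ z, (K z).snd = P z.2) ∧
      (∀ x, ∫⁻ z, weightedDiscrete V β z.1 z.2 ∂(K (x, x)) = 0) ∧
      (∀ x y, ∫⁻ z, weightedDiscrete V β z.1 z.2 ∂(K (x, y)) ≤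
        2 + β * ∫⁻ x', V x' ∂(P x) + β * ∫⁻ y', V y' ∂(P y)) ∧
      (∀ x ∈ G, ∀ y ∈ G, ∫⁻ z, weightedDiscrete V β z.1 z.2 ∂(K (x, y)) ≤
        2 * (1 - α : ℝ≥0) + β * ∫⁻ x', V x' ∂(P x) + β * ∫⁻ y', V y' ∂(P y)) := by
  classical
  obtain ⟨R, hR, hPR⟩ := exists_residual_kernel P hG hα ν₀ hmin
  have hdiag : Measurable fun x : X => (x, x) := by fun_prop
  have hd := measurable_weightedDiscrete hV β
  let Kd : Kernel (X × X) (X × X) := (P.comap Prod.fst measurable_fst).map fun x => (x, x)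
  let Kp (Q : Kernel X X) : Kernel (X × X) (X × X) :=
    (Q.comap Prod.fst measurable_fst) ×ₖ (Q.comap Prod.snd measurable_snd)
  have hKd : ∀ z, Kd z = (P z.1).map fun x => (x, x) := fun z => by
    simp [Kd, Kernel.map_apply _ hdiag, Kernel.comap_apply]
  have hKp : ∀ (Q : Kernel X X) [IsMarkovKernel Q] z, Kp Q z = (Q z.1).prod (Q z.2) :=
    fun Q _ z => by simp [Kp, Kernel.prod_apply, Kernel.comap_apply]
  let Km : Kernel (X × X) (X × X) :=
    { toFun := fun z => α • ν₀.map (fun x => (x, x)) + (1 - α) • Kp R z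
      measurable' := by
        refine Measure.measurable_of_measurable_coe _ fun s hs => ?_
        simp only [Measure.add_apply, Measure.smul_apply]
        exact measurable_const.add (((Kp R).measurable_coe hs).const_smul _) }
  have hKm : ∀ z, Km z = α • ν₀.map (fun x => (x, x)) + (1 - α) • (R z.1).prod (R z.2) :=
    fun z => by rw [← hKp]; rfl
  -- On the diagonal the copies move together. Off it, inside `G × G`, they share a draw from `ν₀`
  -- with weight `α` and otherwise draw independently from the residual kernel; elsewhere they move
  -- independently.
  let K : Kernel (X × X) (X × X) := Kernel.piecewise (measurableSet_diagonal (α := X)) Kd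
    (Kernel.piecewise (hG.prod hG) Km (Kp P))
  have hK1 : ∀ x, K (x, x) = (P x).map fun x => (x, x) := fun x => by
    simp [K, Kernel.piecewise_apply, hKd]
  have hK2 : ∀ x y, x ≠ y → x ∈ G → y ∈ G →
      K (x, y) = α • ν₀.map (fun x => (x, x)) + (1 - α) • (R x).prod (R y) := fun x y h hx hy => by
    simp [K, Kernel.piecewise_apply, h, hx, hy, hKm]
  have hK3 : ∀ x y, x ≠ y → ¬ (x ∈ G ∧ y ∈ G) → K (x, y) = (P x).prod (P y) :=
    fun x y h hxy => by
      rw [← hKp P (x, y)]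
      simp [K, Kernel.piecewise_apply, h, Set.mem_prod, hxy]
  have hprod := fun (μ ν : Measure X) [IsProbabilityMeasure μ] [IsProbabilityMeasure ν] =>
    lintegral_weightedDiscrete_prod_le hV β μ ν
  have hd0 : ∀ μ : Measure X, ∫⁻ z, weightedDiscrete V β z.1 z.2 ∂(μ.map fun x => (x, x)) = 0 := by
    intro μ
    rw [lintegral_map hd hdiag]
    simp [weightedDiscrete_self]
  have hGc : ∀ x ∈ G, ∀ y ∈ G, ∫⁻ z, weightedDiscrete V β z.1 z.2 ∂(K (x, y)) ≤
        2 * (1 - α : ℝ≥0) + β * ∫⁻ x', V x' ∂(P x) + β * ∫⁻ y', V y' ∂(P y) := by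
    intro x hx y hy
    by_cases h : x = y
    · rw [← h, hK1, hd0]; exact zero_le
    -- Since `(1 - α) R x ≤ P x`, the weight `1 - α` turns residual moments into moments of `P`, so
    -- the gain is all in the constant `2`.
    have hle : ∀ x ∈ G, (1 - α : ℝ≥0) * ∫⁻ x', V x' ∂(R x) ≤ ∫⁻ x', V x' ∂(P x) := by
      intro x hx
      rw [hPR x hx, lintegral_add_measure, lintegral_smul_measure, lintegral_smul_measure]
      exact le_add_self
    rw [hK2 x y h hx hy, lintegral_add_measure, lintegral_smul_measure, lintegral_smul_measure, hd0,
      smul_zero, zero_add, ENNReal.smul_def, smul_eq_mul]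
    calc _ ≤ ((1 - α : ℝ≥0) : ℝ≥0∞) *
          (2 + β * ∫⁻ x, V x ∂(R x) + β * ∫⁻ x, V x ∂(R y)) := by gcongr; exact hprod _ _
      _ = 2 * (1 - α : ℝ≥0) + β * ((1 - α : ℝ≥0) * ∫⁻ x', V x' ∂(R x)) +
          β * ((1 - α : ℝ≥0) * ∫⁻ x', V x' ∂(R y)) := by ring
      _ ≤ _ := by gcongr <;> apply hle <;> assumption
  refine ⟨K, fun ⟨x, y⟩ => ?_, fun ⟨x, y⟩ => ?_, fun x => by rw [hK1, hd0], fun x y => ?_, hGc⟩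
  · by_cases h : x = y
    · rw [← h, hK1, Measure.fst, Measure.map_map measurable_fst hdiag]
      exact Measure.map_id
    · by_cases hxy : x ∈ G ∧ y ∈ G
      · ext s hs
        rw [hK2 x y h hxy.1 hxy.2, hPR x hxy.1, Measure.fst_apply hs, Measure.add_apply,
          Measure.smul_apply, Measure.smul_apply, Measure.map_apply hdiag (measurable_fst hs),
          ← Measure.fst_apply hs, Measure.fst_prod]
        rfl
      · rw [hK3 x y h hxy, Measure.fst_prod]
  · by_cases h : x = y
    · rw [← h, hK1, Measure.snd, Measure.map_map measurable_snd hdiag]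
      exact Measure.map_id
    · by_cases hxy : x ∈ G ∧ y ∈ G
      · ext s hs
        rw [hK2 x y h hxy.1 hxy.2, hPR y hxy.2, Measure.snd_apply hs, Measure.add_apply,
          Measure.smul_apply, Measure.smul_apply, Measure.map_apply hdiag (measurable_snd hs),
          ← Measure.snd_apply hs, Measure.snd_prod]
        rfl
      · rw [hK3 x y h hxy, Measure.snd_prod]
  · by_cases h : x = y
    · rw [← h, hK1, hd0]; exact zero_le
    · by_cases hxy : x ∈ G ∧ y ∈ G
      · refine (hGc x hxy.1 y hxy.2).trans ?_
        gcongr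
        exact mul_le_of_le_one_right' (by exact_mod_cast tsub_le_self)
      · rw [hK3 x y h hxy]; exact hprod _ _

/-- The choice of constants turning a drift condition and a minorization condition into a
contraction. -/
lemma exists_contraction_constants {γ K R α : ℝ} (hγ0 : 0 ≤ γ) (hγ : γ < 1) (hK : 0 ≤ K)
    (hR : R = 4 * K / (1 - γ) + 1) (hα0 : 0 < α) (hα : α < 1) :
    ∃ β η : ℝ, 0 < β ∧ 0 < η ∧ η < 1 ∧
      (∀ s, 0 ≤ s → 2 * (1 - α) + β * (γ * s + 2 * K) ≤ η * (2 + β * s)) ∧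
      (∀ s, R ≤ s → 2 + β * (γ * s + 2 * K) ≤ η * (2 + β * s)) := by
  have h1 : 0 < 1 - γ := by linarith
  -- The term `4K/(1-γ)` in `R` gives this bound, and the `+ 1` makes `R` positive even if `K = 0`.
  have hRK : 2 * K ≤ (1 - γ) / 2 * R := by
    rw [hR]; field_simp; nlinarith
  have hR0 : 0 < R := by rw [hR]; positivity
  -- With `2Kβ ≤ α`, the additive drift term uses up at most half of the gain `2α`, which leaves the
  -- factor `1 - α/2` on the constant `2`.
  set β := α / (2 * K + 1) with hβ
  have hβ0 : 0 < β := by positivity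
  have hβK : β * (2 * K) ≤ α := by
    rw [hβ, div_mul_eq_mul_div, div_le_iff₀ (by positivity)]; nlinarith
  -- For `s ≥ R`, half of the gap `1 - γ` absorbs `2K`, so `γ s + 2K ≤ γ' s`. The ratio `(2 +
  -- βγ's)/(2 + βs)` decreases in `s`; `η₁` is its value at `R`.
  set γ' := (1 + γ) / 2 with hγ'
  have hγ'1 : γ' < 1 := by rw [hγ']; linarith
  have hγ'0 : 0 < γ' := by rw [hγ']; linarith
  set η₁ := (2 + β * γ' * R) / (2 + β * R) with hη₁
  have hβR : 0 < β * R := by positivity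
  have hη₁1 : η₁ < 1 := by
    rw [hη₁, div_lt_one (by positivity)]; nlinarith
  refine ⟨β, max η₁ (max (1 - α / 2) γ), hβ0, ?_, ?_, fun s hs => ?_, fun s hs => ?_⟩
  · exact lt_max_of_lt_right (lt_max_of_lt_left (by linarith))
  · exact max_lt hη₁1 (max_lt (by linarith) hγ)
  · have e1 : 1 - α / 2 ≤ max η₁ (max (1 - α / 2) γ) := le_max_of_le_right (le_max_left _ _)
    have e2 : γ ≤ max η₁ (max (1 - α / 2) γ) := le_max_of_le_right (le_max_right _ _)
    have e3 := mul_le_mul_of_nonneg_right e2 (mul_nonneg hβ0.le hs)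
    nlinarith
  · have hs0 : 0 < s := hR0.trans_le hs
    have e1 : η₁ * (2 + β * s) ≤ max η₁ (max (1 - α / 2) γ) * (2 + β * s) :=
      mul_le_mul_of_nonneg_right (le_max_left _ _) (by positivity)
    refine le_trans ?_ e1
    have e2 : 2 * K ≤ (1 - γ) / 2 * s := hRK.trans (by gcongr)
    have e3 : 2 + β * (γ * s + 2 * K) ≤ 2 + β * (γ' * s) := by
      gcongr; rw [hγ']; linarith
    refine e3.trans ?_
    clear_value β γ'
    rw [hη₁, div_mul_eq_mul_div, le_div_iff₀ (by positivity)]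
    have e4 : 0 ≤ β * (s - R) * (1 - γ') :=
      mul_nonneg (mul_nonneg hβ0.le (by linarith)) (by linarith)
    nlinarith

/-- Harris' theorem in the form of Hairer and Mattingly: a geometric drift condition together with
a minorization condition on the sublevel sets of the Lyapunov function make the kernel a
contraction for a weighted Wasserstein distance. -/
theorem exists_wasserstein_contraction [MeasurableEq X] (P : Kernel X X) [IsMarkovKernel P]
    {V : X → ℝ≥0} (hV : Measurable V) {γ K : ℝ≥0} (hγ : γ < 1)
    (hdrift : ∀ x, ∫⁻ y, V y ∂(P x) ≤ γ * V x + K)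
    (hmin : ∀ r : ℝ≥0, ∃ α : ℝ≥0, 0 < α ∧ α < 1 ∧ ∃ ν₀ : Measure X, IsProbabilityMeasure ν₀ ∧
      ∀ x, V x ≤ r → α • ν₀ ≤ P x) :
    ∃ β η : ℝ≥0, 0 < β ∧ 0 < η ∧ η < 1 ∧ ∀ μ₁ μ₂ : Measure X,
      wasserstein (weightedDiscrete V β) (μ₁.bind P) (μ₂.bind P) ≤
        η * wasserstein (weightedDiscrete V β) μ₁ μ₂ := by
  have hR0 : (0 : ℝ) ≤ 4 * K / (1 - γ) + 1 := by
    have : (0 : ℝ) < 1 - γ := sub_pos.2 (by exact_mod_cast hγ)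
    positivity
  -- Order of choice: `R` depends only on the drift, `α` on the sublevel set at height `R`, then `β`
  -- and `η` on all of these.
  obtain ⟨R, hR⟩ : ∃ R : ℝ≥0, (R : ℝ) = 4 * K / (1 - γ) + 1 := ⟨⟨_, hR0⟩, rfl⟩
  obtain ⟨α, hα0, hα1, ν₀, hν₀, hle⟩ := hmin R
  obtain ⟨β', η', hβ0, hη0, hη1, hsmall, hlarge⟩ :=
    exists_contraction_constants (γ := γ) (K := K) (R := R) (α := α) γ.2 (by exact_mod_cast hγ) K.2
      hR (by exact_mod_cast hα0) (by exact_mod_cast hα1)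
  lift β' to ℝ≥0 using hβ0.le with β
  lift η' to ℝ≥0 using hη0.le with η
  refine ⟨β, η, by exact_mod_cast hβ0, by exact_mod_cast hη0, by exact_mod_cast hη1, ?_⟩
  obtain ⟨L, hfst, hsnd, hdiag, hall, hG⟩ := exists_coupling_kernel P (G := {x | V x ≤ R})
    (measurableSet_le hV measurable_const) hα1 ν₀ hle hV β
  refine wasserstein_bind_le (measurable_weightedDiscrete hV β) hfst hsnd
    (by exact_mod_cast hη0.ne') ENNReal.coe_ne_top ?_
  rintro ⟨x, y⟩
  simp only
  by_cases h : x = y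
  · rw [← h, hdiag]; exact zero_le
  rw [weightedDiscrete_of_ne _ _ h]
  have hdr : ∀ c : ℝ≥0, (c : ℝ≥0∞) + β * ∫⁻ x', V x' ∂(P x) + β * ∫⁻ y', V y' ∂(P y) ≤
      ((c + β * (γ * (V x + V y) + 2 * K) : ℝ≥0) : ℝ≥0∞) := fun c => by
    calc _ ≤ (c : ℝ≥0∞) + β * (γ * V x + K) + β * (γ * V y + K) := by
          gcongr <;> apply hdrift
      _ = _ := by push_cast; ring
  have hη : (η : ℝ≥0∞) * (2 + β * V x + β * V y) =
      ((η * (2 + β * (V x + V y)) : ℝ≥0) : ℝ≥0∞) := by push_cast; ring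
  rw [hη]
  -- A sum at most `R` puts both points in the small set, where the copies may meet; above `R`,
  -- drift alone contracts.
  by_cases hxy : V x + V y ≤ R
  · refine (hG x (le_self_add.trans hxy) y (le_add_self.trans hxy)).trans ?_
    have e : ((2 * (1 - α) : ℝ≥0) : ℝ≥0∞) = 2 * ((1 - α : ℝ≥0) : ℝ≥0∞) := by
      rw [ENNReal.coe_mul]; rfl
    rw [← e]
    refine (hdr _).trans ?_
    rw [ENNReal.coe_le_coe, ← NNReal.coe_le_coe]
    push_cast [NNReal.coe_sub hα1.le]
    exact hsmall _ (by positivity)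
  · refine (hall x y).trans ((hdr 2).trans ?_)
    norm_cast
    rw [← NNReal.coe_le_coe]
    push_cast
    exact hlarge _ (by exact_mod_cast (not_le.1 hxy).le)

end Contraction

/-! ### Setwise limits, the invariant measure, uniqueness and ergodicity. -/

section Harris

open Filter Topology
open scoped NNReal

variable {X : Type*} [MeasurableSpace X]

lemma abs_real_sub_le_of_tvNorm_le {μ ν : Measure X} {c : ℝ≥0} (h : tvNorm μ ν ≤ c) {s : Set X}
    (hs : MeasurableSet s) : |μ.real s - ν.real s| ≤ c := by
  have h1 : ENNReal.ofReal |μ.real s - ν.real s| ≤ tvNorm μ ν := by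
    unfold tvNorm
    refine (le_iSup₂ (f := fun (s : Set X) (_ : MeasurableSet s) =>
      ENNReal.ofReal |μ.real s - ν.real s|) s hs).trans ?_
    exact le_mul_of_one_le_left' (by norm_num)
  have h2 := h1.trans h
  rw [← ENNReal.ofReal_coe_nnreal] at h2
  exact (ENNReal.ofReal_le_ofReal_iff c.2).1 h2

/-- A sequence of probability measures which is uniformly Cauchy on measurable sets converges,
uniformly on measurable sets, to a probability measure. -/
lemma exists_setwise_limit (m : ℕ → Measure X) [∀ t, IsProbabilityMeasure (m t)] {ε : ℕ → ℝ}
    (hε : Tendsto ε atTop (𝓝 0))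
    (h : ∀ s, MeasurableSet s → ∀ t k, t ≤ k → |(m t).real s - (m k).real s| ≤ ε t) :
    ∃ ν : Measure X, IsProbabilityMeasure ν ∧
      ∀ s, MeasurableSet s → ∀ t, |(m t).real s - ν.real s| ≤ ε t := by
  have hlim : ∀ s, ∃ a, MeasurableSet s → Tendsto (fun t => (m t).real s) atTop (𝓝 a) := by
    intro s
    by_cases hs : MeasurableSet s
    · have hc : CauchySeq fun t => (m t).real s :=
        cauchySeq_of_le_tendsto_0' ε (fun t k htk => h s hs t k htk) hε
      exact ⟨_, fun _ => hc.tendsto_limUnder⟩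
    · exact ⟨0, fun h => absurd h hs⟩
  choose L hL using hlim
  have hL0 : ∀ s, MeasurableSet s → 0 ≤ L s := fun s hs =>
    ge_of_tendsto' (hL s hs) fun t => measureReal_nonneg
  have hLε : ∀ s, MeasurableSet s → ∀ t, |(m t).real s - L s| ≤ ε t := fun s hs t =>
    le_of_tendsto ((tendsto_const_nhds.sub (hL s hs)).abs)
      ((eventually_ge_atTop t).mono fun k hk => h s hs t k hk)
  have hsum : ∀ f : ℕ → Set X, (∀ i, MeasurableSet (f i)) → Pairwise (Function.onFun Disjoint f) →
      HasSum (fun i => L (f i)) (L (⋃ i, f i)) := by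
    intro f hf hdisj
    have hfin : ∀ t n, ∑ i ∈ Finset.range n, (m t).real (f i) =
        (m t).real (⋃ i ∈ Finset.range n, f i) := fun t n =>
      (measureReal_biUnion_finset (fun i _ j _ hij => hdisj hij) fun i _ => hf i).symm
    have hmeas : ∀ n, MeasurableSet (⋃ i ∈ Finset.range n, f i) := fun n =>
      Finset.measurableSet_biUnion _ fun i _ => hf i
    have hLfin : ∀ n, ∑ i ∈ Finset.range n, L (f i) = L (⋃ i ∈ Finset.range n, f i) := fun n =>
      tendsto_nhds_unique (tendsto_finsetSum _ fun i _ => hL (f i) (hf i))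
        (by simpa only [hfin] using hL _ (hmeas n))
    rw [hasSum_iff_tendsto_nat_of_nonneg fun i => hL0 _ (hf i)]
    -- Countable additivity is an exchange of the limits in `t` and in the number of summands. The
    -- bound `ε t` does not depend on the set, so convergence in `t` is uniform in `n`.
    refine TendstoUniformlyOnFilter.tendsto_of_eventually_tendsto (p := atTop)
      (F := fun t n => ∑ i ∈ Finset.range n, (m t).real (f i))
      (L := fun t => (m t).real (⋃ i, f i)) ?_ (Eventually.of_forall fun t => ?_)
      (hL _ (MeasurableSet.iUnion hf))
    · rw [Metric.tendstoUniformlyOnFilter_iff]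
      intro δ hδ
      have he : ∀ᶠ t in atTop, ε t < δ := hε.eventually (gt_mem_nhds hδ)
      refine (he.prod_inl atTop).mono fun p hp => ?_
      rw [hfin, hLfin, dist_comm]
      exact (hLε _ (hmeas _) _).trans_lt hp
    · have h1 : HasSum (fun i => (m t).real (f i)) ((m t).real (⋃ i, f i)) := by
        rw [measureReal_def, measure_iUnion hdisj hf, ENNReal.tsum_toReal_eq fun i => measure_ne_top _ _]
        refine ENNReal.hasSum_toReal ?_
        rw [← measure_iUnion hdisj hf]
        exact measure_ne_top _ _
      exact h1.tendsto_sum_nat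
  have hL_empty : L ∅ = 0 := tendsto_nhds_unique (hL ∅ .empty) (by simp)
  have hL_univ : L Set.univ = 1 := tendsto_nhds_unique (hL _ .univ) (by simp)
  let ν : Measure X := Measure.ofMeasurable (fun s _ => ENNReal.ofReal (L s)) (by simp [hL_empty])
    fun f hf hdisj => by
      have hs := hsum f hf hdisj
      rw [← hs.tsum_eq, ENNReal.ofReal_tsum_of_nonneg (fun i => hL0 _ (hf i)) hs.summable]
  have hν : ∀ s, MeasurableSet s → ν s = ENNReal.ofReal (L s) := fun s hs =>
    Measure.ofMeasurable_apply s hs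
  refine ⟨ν, ⟨by rw [hν _ .univ, hL_univ, ENNReal.ofReal_one]⟩, fun s hs t => ?_⟩
  rw [measureReal_def ν, hν s hs, ENNReal.toReal_ofReal (hL0 s hs)]
  exact hLε s hs t

/-- A Fatou property for setwise convergence of measures. -/
lemma lintegral_le_of_tendsto_setwise {m : ℕ → Measure X} {ν : Measure X}
    (h : ∀ s, MeasurableSet s → Tendsto (fun t => m t s) atTop (𝓝 (ν s))) {f : X → ℝ≥0∞}
    {c : ℕ → ℝ≥0∞} {a : ℝ≥0∞} (hc : Tendsto c atTop (𝓝 a)) (hfc : ∀ t, ∫⁻ x, f x ∂(m t) ≤ c t) :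
    ∫⁻ x, f x ∂ν ≤ a := by
  -- It suffices to test simple functions below `f` with finite values: their integrals are finite
  -- sums of masses of fibres, which converge.
  rw [lintegral_eq_nnreal]
  refine iSup₂_le fun φ hφ => ?_
  have h1 : Tendsto (fun t => (φ.map ((↑) : ℝ≥0 → ℝ≥0∞)).lintegral (m t)) atTop
      (𝓝 ((φ.map ((↑) : ℝ≥0 → ℝ≥0∞)).lintegral ν)) := by
    simp only [SimpleFunc.map_lintegral]
    exact tendsto_finsetSum _ fun y _ => ENNReal.Tendsto.const_mul
      (h _ (φ.measurableSet_fiber y)) (Or.inr ENNReal.coe_ne_top)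
  refine le_of_tendsto_of_tendsto' h1 hc fun t => le_trans ?_ (hfc t)
  rw [← SimpleFunc.lintegral_eq_lintegral]
  exact lintegral_mono fun x => hφ x

instance Kernel.isMarkovKernel_pow (P : Kernel X X) [IsMarkovKernel P] (t : ℕ) :
    IsMarkovKernel (P ^ t) := by
  induction t with
  | zero => exact inferInstanceAs (IsMarkovKernel Kernel.id)
  | succ t ih => exact inferInstanceAs (IsMarkovKernel ((P ^ t : Kernel X X) ∘ₖ P))

lemma bind_pow_zero (P : Kernel X X) (μ : Measure X) : μ.bind (P ^ 0 : Kernel X X) = μ :=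
  Measure.id_comp

lemma bind_pow_succ (P : Kernel X X) (μ : Measure X) (t : ℕ) :
    μ.bind (P ^ (t + 1) : Kernel X X) = (μ.bind P).bind (P ^ t : Kernel X X) := by
  rw [Measure.comp_assoc]; rfl

lemma bind_pow_succ' (P : Kernel X X) (μ : Measure X) (t : ℕ) :
    μ.bind (P ^ (t + 1) : Kernel X X) = (μ.bind (P ^ t : Kernel X X)).bind P := by
  rw [Measure.comp_assoc, pow_succ']; rfl

lemma bind_pow_add (P : Kernel X X) (μ : Measure X) (t k : ℕ) :
    μ.bind (P ^ (t + k) : Kernel X X) = (μ.bind (P ^ k : Kernel X X)).bind (P ^ t : Kernel X X) := by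
  rw [Measure.comp_assoc, pow_add]; rfl

lemma Kernel.Invariant.bind_pow {P : Kernel X X} {μ : Measure X} (h : P.Invariant μ) (t : ℕ) :
    μ.bind (P ^ t : Kernel X X) = μ := by
  induction t with
  | zero => exact bind_pow_zero P μ
  | succ t ih => rw [bind_pow_succ, h.def, ih]

lemma wasserstein_bind_pow_le {d : X → X → ℝ≥0∞} {P : Kernel X X} {η : ℝ≥0∞}
    (h : ∀ μ₁ μ₂ : Measure X, wasserstein d (μ₁.bind P) (μ₂.bind P) ≤ η * wasserstein d μ₁ μ₂)
    (t : ℕ) (μ₁ μ₂ : Measure X) :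
    wasserstein d (μ₁.bind (P ^ t : Kernel X X)) (μ₂.bind (P ^ t : Kernel X X)) ≤
      η ^ t * wasserstein d μ₁ μ₂ := by
  induction t generalizing μ₁ μ₂ with
  | zero => rw [bind_pow_zero, bind_pow_zero, pow_zero, one_mul]
  | succ t ih =>
    rw [bind_pow_succ, bind_pow_succ, pow_succ, mul_assoc]
    exact (ih _ _).trans (by gcongr; exact h _ _)

lemma tvNorm_bind_pow_le [MeasurableEq X] {V : X → ℝ≥0} (hV : Measurable V) {β η : ℝ≥0}
    {P : Kernel X X} [IsMarkovKernel P]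
    (h : ∀ μ₁ μ₂ : Measure X, wasserstein (weightedDiscrete V β) (μ₁.bind P) (μ₂.bind P) ≤
      η * wasserstein (weightedDiscrete V β) μ₁ μ₂) (t : ℕ) (μ ν : Measure X)
    [IsProbabilityMeasure μ] [IsProbabilityMeasure ν] :
    tvNorm (μ.bind (P ^ t : Kernel X X)) (ν.bind (P ^ t : Kernel X X)) ≤
      η ^ t * (2 + β * ∫⁻ x, V x ∂μ + β * ∫⁻ x, V x ∂ν) := by
  refine (tvNorm_le_wasserstein V β _ _).trans ((wasserstein_bind_pow_le h t μ ν).trans ?_)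
  gcongr
  exact wasserstein_weightedDiscrete_le hV β μ ν

/-- The drift map `s ↦ γ s + K` sends `[0, D]` into itself, so the moment bound survives every step.
-/
lemma lintegral_bind_pow_le {P : Kernel X X} {V : X → ℝ≥0} (hV : Measurable V) {γ K D : ℝ≥0}
    (hdrift : ∀ x, ∫⁻ y, V y ∂(P x) ≤ γ * V x + K) (hD : γ * D + K ≤ D) {μ : Measure X}
    [IsProbabilityMeasure μ] [IsMarkovKernel P] (hμ : ∫⁻ x, V x ∂μ ≤ D) (t : ℕ) :
    ∫⁻ x, V x ∂(μ.bind (P ^ t : Kernel X X)) ≤ D := by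
  induction t with
  | zero => rwa [bind_pow_zero]
  | succ t ih =>
    rw [bind_pow_succ', Measure.lintegral_bind P.aemeasurable (by fun_prop)]
    refine (lintegral_mono hdrift).trans ?_
    rw [lintegral_add_right _ measurable_const, lintegral_const_mul _ (by fun_prop)]
    simp only [lintegral_const, measure_univ, mul_one]
    calc _ ≤ (γ : ℝ≥0∞) * D + K := by gcongr
      _ ≤ D := by exact_mod_cast hD

/-- An invariant probability measure which is the only one is ergodic. -/
lemma IsErgodicInvariant.of_unique {P : Kernel X X} [IsMarkovKernel P] {ν : Measure X}
    [IsProbabilityMeasure ν] (hν : P.Invariant ν)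
    (huniq : ∀ μ : Measure X, IsProbabilityMeasure μ → P.Invariant μ → μ = ν) :
    IsErgodicInvariant P ν := by
  refine ⟨hν, fun s hs hinv => ?_⟩
  by_cases h0 : ν s = 0
  · exact Or.inl h0
  right
  -- Almost no mass started in `s` leaves `s`, and what arrives in `T ∩ s` is at most `ν (T ∩ s)` by
  -- invariance. Equal total masses turn this into equality, so the conditional measure is invariant
  -- and must be `ν`.
  have hle : (ν.restrict s).bind P ≤ ν.restrict s := by
    refine Measure.le_iff.2 fun T hT => ?_
    rw [Measure.bind_apply hT P.aemeasurable, Measure.restrict_apply hT]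
    calc ∫⁻ x in s, P x T ∂ν ≤ ∫⁻ x in s, P x (T ∩ s) ∂ν := by
          refine lintegral_mono_ae ?_
          refine (ae_restrict_iff' hs).2 ?_
          filter_upwards [hinv] with x hx hxs
          have hc : P x sᶜ = 0 := (prob_compl_eq_zero_iff hs).2 (hx hxs)
          rw [measure_inter_conull' (measure_mono_null (fun y hy => hy.2) hc)]
      _ ≤ ∫⁻ x, P x (T ∩ s) ∂ν := lintegral_mono' Measure.restrict_le_self le_rfl
      _ = ν (T ∩ s) := by
          rw [← Measure.bind_apply (hT.inter hs) P.aemeasurable, hν.def]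
  have heq : (ν.restrict s).bind P = ν.restrict s := by
    refine Measure.eq_of_le_of_measure_univ_eq hle ?_
    rw [Measure.bind_apply .univ P.aemeasurable]
    simp
  have hcond : P.Invariant ν[|s] := by
    ext T hT
    rw [Measure.bind_apply hT P.aemeasurable, ProbabilityTheory.cond, lintegral_smul_measure,
      ← Measure.bind_apply hT P.aemeasurable, heq, Measure.smul_apply]
  have h1 := huniq _ (cond_isProbabilityMeasure h0) hcond
  rw [← h1, cond_apply hs, Set.inter_self, ENNReal.inv_mul_cancel h0 (measure_ne_top _ _)]

/-- A Markov kernel satisfying a drift condition and contracting the weighted Wasserstein distance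
has a unique invariant probability measure, to which it converges geometrically in total
variation. -/
theorem exists_invariant_of_contraction [MeasurableEq X] [Nonempty X] (P : Kernel X X)
    [IsMarkovKernel P] {V : X → ℝ≥0} (hV : Measurable V) {γ K β η : ℝ≥0} (hγ : γ < 1)
    (hη : η < 1) (hdrift : ∀ x, ∫⁻ y, V y ∂(P x) ≤ γ * V x + K)
    (hcontr : ∀ μ₁ μ₂ : Measure X,
      wasserstein (weightedDiscrete V β) (μ₁.bind P) (μ₂.bind P) ≤
        η * wasserstein (weightedDiscrete V β) μ₁ μ₂) :
    ∃ ν : Measure X, IsProbabilityMeasure ν ∧ IsErgodicInvariant P ν ∧ ∫⁻ x, V x ∂ν ≠ ∞ ∧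
      (∀ μ : Measure X, IsProbabilityMeasure μ → P.Invariant μ → μ = ν) ∧
      ∀ (t : ℕ) (μ : Measure X) [IsProbabilityMeasure μ],
        tvNorm (μ.bind (P ^ t : Kernel X X)) ν ≤
          η ^ t * (2 + β * ∫⁻ x, V x ∂μ + β * ∫⁻ x, V x ∂ν) := by
  obtain ⟨x₀⟩ := ‹Nonempty X›
  have h1γ : 1 - γ ≠ 0 := (tsub_pos_of_lt hγ).ne'
  -- `K / (1 - γ)` is the fixed point of the drift map; adding `V x₀` covers the Dirac start and
  -- keeps `D` stable under that map.
  let D : ℝ≥0 := V x₀ + K / (1 - γ)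
  have hD : γ * D + K ≤ D := by
    have e : γ * (K / (1 - γ)) + K = K / (1 - γ) := by
      have : γ + (1 - γ) = 1 := add_tsub_cancel_of_le hγ.le
      calc γ * (K / (1 - γ)) + K = γ * (K / (1 - γ)) + (1 - γ) * (K / (1 - γ)) := by
            rw [mul_div_cancel₀ _ h1γ]
        _ = K / (1 - γ) := by rw [← add_mul, this, one_mul]
    calc γ * D + K = γ * V x₀ + (γ * (K / (1 - γ)) + K) := by simp only [D]; ring
      _ ≤ D := by rw [e]; simp only [D]; gcongr; exact mul_le_of_le_one_left' hγ.le
  let m : ℕ → Measure X := fun t => (Measure.dirac x₀).bind (P ^ t : Kernel X X)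
  have hmV : ∀ t, ∫⁻ x, V x ∂(m t) ≤ D := lintegral_bind_pow_le hV hdrift hD (by
    rw [lintegral_dirac' _ (by fun_prop)]
    exact_mod_cast le_self_add)
  -- `m t` and `m (t + k)` are the images under `P ^ t` of `m 0` and `m k`, whose moments are at
  -- most `D`; hence the bound is uniform in `k`.
  have htv : ∀ t k, tvNorm (m t) (m (t + k)) ≤ ((η ^ t * (2 + β * D + β * D) : ℝ≥0) : ℝ≥0∞) := by
    intro t k
    simp only [m]
    rw [bind_pow_add P _ t k]
    refine (tvNorm_bind_pow_le hV hcontr t _ _).trans ?_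
    push_cast
    gcongr
    · exact hmV 0 |>.trans_eq' (by simp only [m]; rw [bind_pow_zero])
    · exact hmV k
  have hε : Tendsto (fun t => ((η ^ t * (2 + β * D + β * D) : ℝ≥0) : ℝ)) atTop (𝓝 0) := by
    have := (tendsto_pow_atTop_nhds_zero_of_lt_one η.2 (by exact_mod_cast hη)).mul_const
      ((2 + β * D + β * D : ℝ≥0) : ℝ)
    simpa using this
  obtain ⟨ν, hν, hνm⟩ := exists_setwise_limit m hε fun s hs t k htk => by
    obtain ⟨j, rfl⟩ := Nat.exists_eq_add_of_le htk
    exact abs_real_sub_le_of_tvNorm_le (htv t j) hs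
  have hset : ∀ s, MeasurableSet s → Tendsto (fun t => m t s) atTop (𝓝 (ν s)) := by
    intro s hs
    refine (ENNReal.tendsto_toReal_iff (fun t => measure_ne_top _ _) (measure_ne_top _ _)).1 ?_
    rw [tendsto_iff_dist_tendsto_zero]
    exact squeeze_zero (fun _ => dist_nonneg) (fun t => hνm s hs t) hε
  have hinv : P.Invariant ν := by
    -- For probability measures one inequality suffices. It is the Fatou property for `x ↦ P x s`,
    -- whose integral against `m t` is `m (t + 1) s`.
    refine Measure.eq_of_le_of_isProbabilityMeasure (Measure.le_iff.2 fun s hs => ?_)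
    rw [Measure.bind_apply hs P.aemeasurable]
    refine lintegral_le_of_tendsto_setwise hset ((tendsto_add_atTop_iff_nat 1).2 (hset s hs))
      fun t => ?_
    rw [← Measure.bind_apply hs P.aemeasurable, ← bind_pow_succ']
  have hVν : ∫⁻ x, V x ∂ν ≤ D := lintegral_le_of_tendsto_setwise hset tendsto_const_nhds hmV
  have hconv : ∀ (t : ℕ) (μ : Measure X) [IsProbabilityMeasure μ],
      tvNorm (μ.bind (P ^ t : Kernel X X)) ν ≤
        η ^ t * (2 + β * ∫⁻ x, V x ∂μ + β * ∫⁻ x, V x ∂ν) := fun t μ _ => by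
    have := tvNorm_bind_pow_le hV hcontr t μ ν
    rwa [Kernel.Invariant.bind_pow hinv] at this
  have huniq : ∀ μ : Measure X, IsProbabilityMeasure μ → P.Invariant μ → μ = ν := by
    intro μ hμ hμP
    ext s hs
    -- `μ` may have infinite `V`-moment, which makes `hconv` vacuous for it. Convergence from each
    -- point, where `V x` is finite, is instead integrated against `μ` by dominated convergence.
    have hpt : ∀ x, Tendsto (fun t => (P ^ t : Kernel X X) x s) atTop (𝓝 (ν s)) := by
      intro x
      refine (ENNReal.tendsto_toReal_iff (fun t => measure_ne_top _ _) (measure_ne_top _ _)).1 ?_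
      rw [tendsto_iff_dist_tendsto_zero]
      have hε' : Tendsto (fun t => ((η ^ t * (2 + β * V x + β * D) : ℝ≥0) : ℝ)) atTop (𝓝 0) := by
        have := (tendsto_pow_atTop_nhds_zero_of_lt_one η.2 (by exact_mod_cast hη)).mul_const
          ((2 + β * V x + β * D : ℝ≥0) : ℝ)
        simpa using this
      refine squeeze_zero (fun _ => dist_nonneg) (fun t => ?_) hε'
      refine abs_real_sub_le_of_tvNorm_le ?_ hs
      have := hconv t (Measure.dirac x)
      rw [Measure.dirac_bind (Kernel.measurable _), lintegral_dirac' _ (by fun_prop)] at this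
      refine this.trans ?_
      push_cast
      gcongr
    have h1 : ∀ t, ∫⁻ x, (P ^ t : Kernel X X) x s ∂μ = μ s := fun t => by
      rw [← Measure.bind_apply hs (Kernel.aemeasurable _), Kernel.Invariant.bind_pow hμP]
    have h2 := tendsto_lintegral_of_dominated_convergence (μ := μ) (fun _ => 1)
      (fun t => (P ^ t : Kernel X X).measurable_coe hs)
      (fun t => Eventually.of_forall fun x => prob_le_one) (by simp)
      (Eventually.of_forall hpt)
    simp only [h1, lintegral_const, measure_univ, mul_one] at h2
    exact tendsto_nhds_unique tendsto_const_nhds h2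
  exact ⟨ν, hν, .of_unique hinv huniq, (hVν.trans_lt ENNReal.coe_lt_top).ne, huniq, hconv⟩

end Harris

/-! ### A common minorant for Gaussian measures with bounded means. -/

section Gaussian

open scoped NNReal

/-- A product of measures dominates a product of minorants of its factors. -/
lemma pow_smul_pi_le_pi {ι : Type*} [Fintype ι] {Y : ι → Type*} [∀ i, MeasurableSpace (Y i)]
    {μ ν : ∀ i, Measure (Y i)} [∀ i, IsProbabilityMeasure (ν i)] {c : ℝ≥0}
    (h : ∀ i, c • ν i ≤ μ i) : c ^ Fintype.card ι • Measure.pi ν ≤ Measure.pi μ := by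
  refine Measure.le_iff.2 fun s hs => ?_
  -- `OuterMeasure.pi` is the largest outer measure bounded on boxes by the product of the factors,
  -- so comparing on boxes is enough.
  have h1 : (c ^ Fintype.card ι • Measure.pi ν).toOuterMeasure ≤
      OuterMeasure.pi fun i => (μ i).toOuterMeasure := by
    refine OuterMeasure.le_pi.2 fun t _ => ?_
    change (c ^ Fintype.card ι • Measure.pi ν) (Set.univ.pi t) ≤ ∏ i, μ i (t i)
    rw [Measure.smul_apply, Measure.pi_pi, ENNReal.smul_def, smul_eq_mul, ENNReal.coe_pow,
      ← Finset.card_univ, ← Finset.prod_const, ← Finset.prod_mul_distrib]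
    exact Finset.prod_le_prod' fun i _ => h i (t i)
  rw [Measure.pi_def μ]
  exact (h1 s).trans (le_toMeasure_apply _ _ _)

/-- Gaussian measures of unit variance with bounded means have a common minorant. -/
lemma exists_smul_le_gaussianReal (ρ : ℝ) : ∃ c : ℝ≥0, 0 < c ∧ c ≤ 1 ∧
    ∀ a : ℝ, |a| ≤ ρ → c • gaussianReal 0 (1 / 2) ≤ gaussianReal a 1 := by
  have hv : 0 < √(2 * Real.pi * (1 / 2)) := by positivity
  have hs' : 0 < √(2 * Real.pi * 1) := by positivity
  have hle : √(2 * Real.pi * (1 / 2)) ≤ √(2 * Real.pi * 1) := by gcongr; norm_num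
  -- Variance `1/2` is chosen because `(x - a)²/2 ≤ x² + a² ≤ x² + ρ²`. The constant is the ratio of
  -- normalizations times `exp (-ρ²)`.
  have hc0 : 0 < √(2 * Real.pi * (1 / 2)) / √(2 * Real.pi * 1) * Real.exp (-ρ ^ 2) := by positivity
  obtain ⟨c, hc⟩ : ∃ c : ℝ≥0,
      (c : ℝ) = √(2 * Real.pi * (1 / 2)) / √(2 * Real.pi * 1) * Real.exp (-ρ ^ 2) :=
    ⟨⟨_, hc0.le⟩, rfl⟩
  rw [← hc] at hc0
  refine ⟨c, hc0, ?_, fun a ha => ?_⟩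
  · rw [← NNReal.coe_le_coe, hc]
    exact mul_le_one₀ ((div_le_one hs').2 hle) (Real.exp_pos _).le
      (Real.exp_le_one_iff.2 (neg_nonpos.2 (sq_nonneg _)))
  · rw [gaussianReal_of_var_ne_zero _ (by norm_num), gaussianReal_of_var_ne_zero _ one_ne_zero]
    refine Measure.le_iff.2 fun s hs => ?_
    rw [Measure.smul_apply, withDensity_apply _ hs, withDensity_apply _ hs, ENNReal.smul_def,
      smul_eq_mul, ← lintegral_const_mul _ (measurable_gaussianPDF _ _)]
    refine lintegral_mono fun x => ?_
    rw [gaussianPDF, gaussianPDF, ← ENNReal.ofReal_coe_nnreal, ← ENNReal.ofReal_mul hc0.le]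
    refine ENNReal.ofReal_le_ofReal ?_
    rw [hc]
    simp only [gaussianPDFReal, NNReal.coe_div, NNReal.coe_one, NNReal.coe_ofNat]
    have hexp : Real.exp (-ρ ^ 2) * Real.exp (-(x - 0) ^ 2 / (2 * (1 / 2))) ≤
        Real.exp (-(x - a) ^ 2 / (2 * 1)) := by
      rw [← Real.exp_add]
      refine Real.exp_le_exp.2 ?_
      have : a ^ 2 ≤ ρ ^ 2 := sq_le_sq' (abs_le.1 ha).1 (abs_le.1 ha).2
      nlinarith [sq_nonneg (x + a)]
    calc _ = (√(2 * Real.pi * 1))⁻¹ *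
          (Real.exp (-ρ ^ 2) * Real.exp (-(x - 0) ^ 2 / (2 * (1 / 2)))) := by
          generalize Real.exp (-ρ ^ 2) = u
          generalize Real.exp (-(x - 0) ^ 2 / (2 * (1 / 2))) = v
          generalize √(2 * Real.pi * (1 / 2)) = p at hv
          field_simp
      _ ≤ _ := by gcongr

/-- The product form lets the one-dimensional minorant act in each coordinate. -/
lemma map_add_stdGaussian {ι : Type*} [Fintype ι] (a : EuclideanSpace ℝ ι) :
    (stdGaussian (EuclideanSpace ℝ ι)).map (fun z => a + z) =
      (Measure.pi fun i => gaussianReal (a i) 1).map (WithLp.toLp 2) := by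
  have h : (Measure.pi fun i => gaussianReal (a i) 1) =
      (Measure.pi fun _ : ι => gaussianReal 0 1).map fun y i => a i + y i := by
    rw [Measure.pi_map_pi (μ := fun _ => gaussianReal 0 1) (f := fun i y => a i + y)
      fun i => by fun_prop]
    congr 1
    ext1 i
    rw [gaussianReal_map_const_add, zero_add]
  rw [← map_pi_eq_stdGaussian, h, Measure.map_map (by fun_prop) (by fun_prop),
    Measure.map_map (by fun_prop) (by fun_prop)]
  rfl

/-- Translates of the standard Gaussian by bounded vectors have a common minorant. -/
lemma exists_smul_le_map_add_stdGaussian (ι : Type*) [Fintype ι] (ρ : ℝ) :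
    ∃ α : ℝ≥0, 0 < α ∧ α < 1 ∧ ∃ ν₀ : Measure (EuclideanSpace ℝ ι), IsProbabilityMeasure ν₀ ∧
      ∀ a : EuclideanSpace ℝ ι, ‖a‖ ≤ ρ →
        α • ν₀ ≤ (stdGaussian (EuclideanSpace ℝ ι)).map (fun z => a + z) := by
  obtain ⟨c, hc0, hc1, hc⟩ := exists_smul_le_gaussianReal ρ
  have hm : Measurable (WithLp.toLp 2 : (ι → ℝ) → EuclideanSpace ℝ ι) := by fun_prop
  -- Halving secures `α < 1` strictly, also when the power equals `1`, as in dimension zero.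
  refine ⟨c ^ Fintype.card ι / 2, by positivity, ?_,
    (Measure.pi fun _ : ι => gaussianReal 0 (1 / 2)).map (WithLp.toLp 2),
    Measure.isProbabilityMeasure_map hm.aemeasurable, fun a ha => ?_⟩
  · exact NNReal.div_lt_one_of_lt ((pow_le_one₀ zero_le hc1).trans_lt one_lt_two)
  · have h1 := pow_smul_pi_le_pi (μ := fun i => gaussianReal (a i) 1)
      (ν := fun _ : ι => gaussianReal 0 (1 / 2)) (c := c)
      fun i => hc _ ((PiLp.norm_apply_le a i).trans ha)
    rw [map_add_stdGaussian]
    refine Measure.le_iff.2 fun s hs => ?_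
    rw [Measure.smul_apply, Measure.map_apply hm hs, Measure.map_apply hm hs]
    refine le_trans ?_ (h1 (WithLp.toLp 2 ⁻¹' s))
    rw [Measure.smul_apply, ENNReal.smul_def, ENNReal.smul_def]
    gcongr
    exact_mod_cast div_le_self zero_le one_le_two

end Gaussian

/-! ### Minorization and drift for the closed-loop kernel. -/

namespace SLDS

open scoped NNReal

variable {n p M : ℕ}

lemma exists_mem_region (S : SLDS n p M) (x : EuclideanSpace ℝ (Fin n)) : ∃ j, x ∈ S.region j := by
  simpa using (S.iUnion_region ▸ Set.mem_univ x : x ∈ ⋃ j, S.region j)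

lemma sum_indicator_region {Y : Type*} [AddCommMonoid Y] (S : SLDS n p M)
    (f : Fin M → EuclideanSpace ℝ (Fin n) → Y) {x : EuclideanSpace ℝ (Fin n)} {j : Fin M}
    (hx : x ∈ S.region j) : ∑ k, (S.region k).indicator (f k) x = f j x := by
  rw [Finset.sum_eq_single j, Set.indicator_of_mem hx]
  · exact fun k _ hk => Set.indicator_of_notMem
      (fun hxk => (S.disjoint_region k j hk).notMem_of_mem_left hxk hx) _
  · simp

lemma kernel_apply (S : SLDS n p M) (π : Matrix (Fin p) (Fin n) ℝ)
    {x : EuclideanSpace ℝ (Fin n)} {j : Fin M} (hx : x ∈ S.region j) :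
    S.kernel π x =
      (stdGaussian (EuclideanSpace ℝ (Fin n))).map (fun z => S.closedLoopOp π j x + z) :=
  S.sum_indicator_region (fun j y => (stdGaussian (EuclideanSpace ℝ (Fin n))).map
    (fun z => S.closedLoopOp π j y + z)) hx

instance isMarkovKernel_kernel (S : SLDS n p M) (π : Matrix (Fin p) (Fin n) ℝ) :
    IsMarkovKernel (S.kernel π) := by
  refine ⟨fun x => ?_⟩
  obtain ⟨j, hj⟩ := S.exists_mem_region x
  rw [S.kernel_apply π hj]
  exact Measure.isProbabilityMeasure_map (by fun_prop)

/-- There are finitely many modes, so states with `‖x‖² ≤ r` have one-step means of norm at most `L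
√r`, and the Gaussian minorant applies to all of them at once. -/
lemma exists_smul_le_kernel (S : SLDS n p M) (π : Matrix (Fin p) (Fin n) ℝ) (r : ℝ≥0) :
    ∃ α : ℝ≥0, 0 < α ∧ α < 1 ∧ ∃ ν₀ : Measure (EuclideanSpace ℝ (Fin n)),
      IsProbabilityMeasure ν₀ ∧ ∀ x, ‖x‖₊ ^ 2 ≤ r → α • ν₀ ≤ S.kernel π x := by
  let L : ℝ≥0 := Finset.univ.sup fun k => ‖S.closedLoopOp π k‖₊
  obtain ⟨α, h0, h1, ν₀, hν₀, h⟩ :=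
    exists_smul_le_map_add_stdGaussian (Fin n) (L * NNReal.sqrt r : ℝ≥0)
  refine ⟨α, h0, h1, ν₀, hν₀, fun x hx => ?_⟩
  obtain ⟨j, hj⟩ := S.exists_mem_region x
  rw [S.kernel_apply π hj]
  refine h _ ?_
  rw [← coe_nnnorm, NNReal.coe_le_coe]
  refine ((S.closedLoopOp π j).le_opNNNorm x).trans ?_
  gcongr
  · exact Finset.le_sup (f := fun k => ‖S.closedLoopOp π k‖₊) (Finset.mem_univ j)
  · exact NNReal.le_sqrt_iff_sq_le.2 hx

/-- With `b = (1 - g) u` this is convexity of the square with weights `g` and `1 - g`; the defect is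
`g (1 - g) (s - u)²`. It keeps the coefficient of `s²` below one. -/
lemma add_sq_le_of_lt_one {g s b : ℝ} (hg : g < 1) (hg0 : 0 ≤ g) :
    (g * s + b) ^ 2 ≤ g * s ^ 2 + (1 - g)⁻¹ * b ^ 2 := by
  have h : 0 < 1 - g := sub_pos.2 hg
  obtain ⟨u, rfl⟩ : ∃ u, b = (1 - g) * u := ⟨b / (1 - g), by field_simp⟩
  have e : (1 - g)⁻¹ * ((1 - g) * u) ^ 2 = (1 - g) * u ^ 2 := by field_simp
  rw [e]
  nlinarith [mul_nonneg (mul_nonneg hg0 h.le) (sq_nonneg (s - u))]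

/-- The squared norm is a Lyapunov function of the closed-loop system. -/
lemma exists_drift (S : SLDS n p M) (π : Matrix (Fin p) (Fin n) ℝ)
    (hstable : ∃ ϱ : ℝ, ∀ k : Fin M,
      (S.region k ∩ (Metric.closedBall 0 ϱ)ᶜ).Nonempty → ‖S.closedLoopOp π k‖ < 1) :
    ∃ γ K : ℝ≥0, γ < 1 ∧ ∀ x, ∫⁻ y, (‖y‖₊ ^ 2 : ℝ≥0) ∂(S.kernel π x) ≤
      γ * (‖x‖₊ ^ 2 : ℝ≥0) + K := by
  obtain ⟨ϱ, hϱ⟩ := hstable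
  let L : ℝ≥0 := Finset.univ.sup fun k => ‖S.closedLoopOp π k‖₊
  -- Modes of norm at least one are replaced by `0`, so `g < 1`. They are active only where `‖x‖ ≤
  -- ϱ`, and there the constant `c = L ϱ⁺` bounds the image.
  let g : ℝ≥0 := Finset.univ.sup fun k =>
    if ‖S.closedLoopOp π k‖₊ < 1 then ‖S.closedLoopOp π k‖₊ else 0
  have hg : g < 1 := by
    refine (Finset.sup_lt_iff (by simp)).2 fun k _ => ?_
    split_ifs with h
    · exact h
    · exact one_pos
  obtain ⟨c, hc⟩ : ∃ c : ℝ≥0, c = L * ϱ.toNNReal := ⟨_, rfl⟩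
  have hbound : ∀ j, ∀ x ∈ S.region j, ‖S.closedLoopOp π j x‖₊ ≤ g * ‖x‖₊ + c := by
    intro j x hx
    refine ((S.closedLoopOp π j).le_opNNNorm x).trans ?_
    by_cases h : ‖x‖ ≤ ϱ
    · refine le_add_left ?_
      rw [hc]
      gcongr
      · exact Finset.le_sup (f := fun k => ‖S.closedLoopOp π k‖₊) (Finset.mem_univ j)
      · exact NNReal.le_toNNReal_of_coe_le h
    · refine le_add_right ?_
      have hj : ‖S.closedLoopOp π j‖₊ < 1 := hϱ j ⟨x, hx, by simpa using h⟩
      gcongr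
      refine le_trans ?_ (Finset.le_sup (Finset.mem_univ j))
      rw [if_pos hj]
  have hfin : ∫⁻ z, ((c + ‖z‖₊) ^ 2 : ℝ≥0) ∂(stdGaussian (EuclideanSpace ℝ (Fin n))) ≠ ∞ := by
    have h0 := (IsGaussian.memLp_id (stdGaussian (EuclideanSpace ℝ (Fin n))) 2 (by simp)).norm
    have h1 : MemLp (fun z => (c : ℝ) + ‖z‖) 2 (stdGaussian (EuclideanSpace ℝ (Fin n))) :=
      MemLp.add (f := fun _ => (c : ℝ)) (memLp_const _) h0
    have h2 := h1.integrable_sq.lintegral_lt_top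
    have e : ∀ z : EuclideanSpace ℝ (Fin n),
        ENNReal.ofReal (((c : ℝ) + ‖z‖) ^ 2) = (((c + ‖z‖₊) ^ 2 : ℝ≥0) : ℝ≥0∞) := fun z => by
      rw [← ENNReal.ofReal_coe_nnreal, NNReal.coe_pow, NNReal.coe_add, coe_nnnorm]
    simp_rw [e] at h2
    exact h2.ne
  obtain ⟨K', hK'⟩ : ∃ K' : ℝ≥0, (K' : ℝ≥0∞) = _ := ⟨_, ENNReal.coe_toNNReal hfin⟩
  refine ⟨g, (1 - g)⁻¹ * K', hg, fun x => ?_⟩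
  obtain ⟨j, hj⟩ := S.exists_mem_region x
  rw [S.kernel_apply π hj, lintegral_map (by fun_prop) (by fun_prop)]
  have hpt : ∀ z, ‖S.closedLoopOp π j x + z‖₊ ^ 2 ≤
      g * ‖x‖₊ ^ 2 + (1 - g)⁻¹ * (c + ‖z‖₊) ^ 2 := by
    intro z
    have h1 : ‖S.closedLoopOp π j x + z‖₊ ≤ g * ‖x‖₊ + (c + ‖z‖₊) := by
      rw [← add_assoc]
      exact (nnnorm_add_le _ _).trans (by gcongr; exact hbound j x hj)
    refine (pow_le_pow_left₀ zero_le h1 2).trans ?_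
    rw [← NNReal.coe_le_coe]
    push_cast [NNReal.coe_sub hg.le]
    exact add_sq_le_of_lt_one (by exact_mod_cast hg) g.2
  calc _ ≤ ∫⁻ z, ((g : ℝ≥0∞) * (‖x‖₊ ^ 2 : ℝ≥0) +
        ((1 - g)⁻¹ : ℝ≥0) * ((c + ‖z‖₊) ^ 2 : ℝ≥0))
          ∂(stdGaussian (EuclideanSpace ℝ (Fin n))) :=
        lintegral_mono fun z => by
          rw [← ENNReal.coe_mul, ← ENNReal.coe_mul, ← ENNReal.coe_add, ENNReal.coe_le_coe]
          exact hpt z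
    _ = _ := by
        rw [lintegral_add_left measurable_const, lintegral_const, lintegral_const_mul _ (by fun_prop),
          ← hK', measure_univ, mul_one, ENNReal.coe_mul]

end SLDS

/-! ### Laws of trajectories as iterates of the kernel. -/

/-- The joint law factors into three marginals and can be rebracketed. It serves to combine
independence of `x 0` from the noise with independence of past and present noise. -/
lemma ProbabilityTheory.IndepFun.prodMk_assoc {Ω A B C : Type*} [MeasurableSpace Ω]
    [MeasurableSpace A] [MeasurableSpace B] [MeasurableSpace C] {μ : Measure Ω}
    [IsProbabilityMeasure μ] {X : Ω → A} {Y : Ω → B} {Z : Ω → C} (hX : Measurable X)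
    (hY : Measurable Y) (hZ : Measurable Z) (h : IndepFun X (fun ω => (Y ω, Z ω)) μ)
    (h' : IndepFun Y Z μ) : IndepFun (fun ω => (X ω, Y ω)) Z μ := by
  have hXY : IndepFun X Y μ := h.comp (φ := id) (ψ := Prod.fst) measurable_id measurable_fst
  have := Measure.isProbabilityMeasure_map (μ := μ) hX.aemeasurable
  have := Measure.isProbabilityMeasure_map (μ := μ) hY.aemeasurable
  have := Measure.isProbabilityMeasure_map (μ := μ) hZ.aemeasurable
  rw [indepFun_iff_map_prod_eq_prod_map_map (by fun_prop) (by fun_prop)] at h h' hXY ⊢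
  have e : (fun ω => ((X ω, Y ω), Z ω)) =
      MeasurableEquiv.prodAssoc.symm ∘ fun ω => (X ω, (Y ω, Z ω)) := rfl
  rw [e, ← Measure.map_map (MeasurableEquiv.measurable _) (by fun_prop), h, h', hXY,
    ← Measure.prodAssoc_prod, MeasurableEquiv.map_symm_map]

namespace SLDS

open scoped NNReal

variable {n p M : ℕ}

/-- One step of the closed-loop system as a function of the state and the noise. -/
noncomputable def stepMap (S : SLDS n p M) (π : Matrix (Fin p) (Fin n) ℝ)
    (q : EuclideanSpace ℝ (Fin n) × (Fin M → EuclideanSpace ℝ (Fin n))) :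
    EuclideanSpace ℝ (Fin n) :=
  ∑ j, (S.region j).indicator (fun y => S.closedLoopOp π j y + q.2 j) q.1

lemma stepMap_apply (S : SLDS n p M) (π : Matrix (Fin p) (Fin n) ℝ)
    {x : EuclideanSpace ℝ (Fin n)} {j : Fin M} (hx : x ∈ S.region j)
    (v : Fin M → EuclideanSpace ℝ (Fin n)) : S.stepMap π (x, v) = S.closedLoopOp π j x + v j :=
  S.sum_indicator_region (fun j y => S.closedLoopOp π j y + v j) hx

lemma measurable_stepMap (S : SLDS n p M) (π : Matrix (Fin p) (Fin n) ℝ) :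
    Measurable (S.stepMap π) := by
  refine Finset.measurable_sum _ fun j _ => ?_
  have h : (fun q : EuclideanSpace ℝ (Fin n) × (Fin M → EuclideanSpace ℝ (Fin n)) =>
      (S.region j).indicator (fun y => S.closedLoopOp π j y + q.2 j) q.1) =
      (Prod.fst ⁻¹' S.region j).indicator
        fun q : EuclideanSpace ℝ (Fin n) × (Fin M → EuclideanSpace ℝ (Fin n)) =>
          S.closedLoopOp π j q.1 + q.2 j := rfl
  rw [h]
  exact Measurable.indicator (by fun_prop) (measurable_fst (S.measurableSet_region j))

section Trajectory

variable {S : SLDS n p M} {π : Matrix (Fin p) (Fin n) ℝ} {Ω : Type*} [MeasurableSpace Ω]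
  {Pr : Measure Ω} {w : ℕ → Fin M → Ω → EuclideanSpace ℝ (Fin n)}
  {x : ℕ → Ω → EuclideanSpace ℝ (Fin n)}

lemma IsTrajectory.step_eq (h : S.IsTrajectory π Pr w x) (t : ℕ) (ω : Ω) :
    x (t + 1) ω = S.stepMap π (x t ω, fun j => w t j ω) :=
  h.step t ω

lemma IsTrajectory.measurable_noise_pi (h : S.IsTrajectory π Pr w x) (t : ℕ) :
    Measurable fun ω j => w t j ω :=
  measurable_pi_lambda _ (h.measurable_noise t)

/-- The state at time `t` is a measurable function of the initial state and the noise before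
time `t`. -/
lemma IsTrajectory.exists_history (h : S.IsTrajectory π Pr w x) (t : ℕ) :
    ∃ G : EuclideanSpace ℝ (Fin n) × (Finset.range t → Fin M → EuclideanSpace ℝ (Fin n)) →
      EuclideanSpace ℝ (Fin n), Measurable G ∧
      ∀ ω, x t ω = G (x 0 ω, fun i j => w i j ω) := by
  induction t with
  | zero => exact ⟨Prod.fst, measurable_fst, fun ω => rfl⟩
  | succ t ih =>
    obtain ⟨G, hG, hx⟩ := ih
    refine ⟨fun q => S.stepMap π
      (G (q.1, fun i => q.2 ⟨i, Finset.mem_range.2 ((Finset.mem_range.1 i.2).trans t.lt_succ_self)⟩),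
        q.2 ⟨t, Finset.self_mem_range_succ t⟩), ?_, fun ω => ?_⟩
    · refine (S.measurable_stepMap π).comp (Measurable.prodMk (hG.comp ?_) ?_)
      · refine measurable_fst.prodMk (measurable_pi_lambda _ fun i => ?_)
        exact (measurable_pi_apply _).comp measurable_snd
      · exact (measurable_pi_apply _).comp measurable_snd
    · rw [h.step_eq, hx]

lemma IsTrajectory.measurable (h : S.IsTrajectory π Pr w x) (t : ℕ) : Measurable (x t) := by
  induction t with
  | zero => exact h.measurable_init
  | succ t ih =>
    rw [show x (t + 1) = _ from funext (h.step_eq t)]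
    exact (S.measurable_stepMap π).comp (ih.prodMk (h.measurable_noise_pi t))

/-- The state at time `t` is a function of `x 0` and the noise at times before `t`, and this pair is
independent of the noise at time `t`. -/
lemma IsTrajectory.indepFun_state_noise [IsProbabilityMeasure Pr]
    (h : S.IsTrajectory π Pr w x) (t : ℕ) : IndepFun (x t) (fun ω j => w t j ω) Pr := by
  obtain ⟨G, hG, hx⟩ := h.exists_history t
  have hpast : Measurable fun ω (i : Finset.range t) j => w i j ω :=
    measurable_pi_lambda _ fun i => h.measurable_noise_pi i
  have h1 : IndepFun (fun ω (i : Finset.range t) j => w i j ω) (fun ω j => w t j ω) Pr := by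
    have := h.indep_noise.indepFun_finset (Finset.range t) {t} (by simp)
      fun i => h.measurable_noise_pi i
    exact this.comp (φ := id) (ψ := fun v : ({t} : Finset ℕ) → Fin M → EuclideanSpace ℝ (Fin n) =>
      v ⟨t, Finset.mem_singleton_self t⟩) measurable_id (measurable_pi_apply _)
  have h2 : IndepFun (x 0) (fun ω => ((fun (i : Finset.range t) j => w i j ω),
      fun j => w t j ω)) Pr :=
    h.indep_init.comp (φ := id) (ψ := fun v : ℕ → Fin M → EuclideanSpace ℝ (Fin n) =>
      ((fun i : Finset.range t => v i), v t))
      measurable_id (by fun_prop)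
  have h3 := IndepFun.prodMk_assoc h.measurable_init hpast (h.measurable_noise_pi t) h2 h1
  have h4 := h3.comp hG (measurable_id (α := Fin M → EuclideanSpace ℝ (Fin n)))
  rw [show x t = _ from funext hx]
  exact h4

lemma IsTrajectory.map_succ [IsProbabilityMeasure Pr] (h : S.IsTrajectory π Pr w x) (t : ℕ) :
    Pr.map (x (t + 1)) = (Pr.map (x t)).bind (S.kernel π) := by
  have hw := h.measurable_noise_pi t
  have hx := h.measurable t
  have := Measure.isProbabilityMeasure_map (μ := Pr) hw.aemeasurable
  have hjoint := (indepFun_iff_map_prod_eq_prod_map_map hx.aemeasurable hw.aemeasurable).1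
    (h.indepFun_state_noise t)
  rw [show x (t + 1) = S.stepMap π ∘ fun ω => (x t ω, fun j => w t j ω) from funext (h.step_eq t),
    ← Measure.map_map (S.measurable_stepMap π) (hx.prodMk hw), hjoint]
  ext s hs
  rw [Measure.map_apply (S.measurable_stepMap π) hs,
    Measure.prod_apply (S.measurable_stepMap π hs), Measure.bind_apply hs (Kernel.aemeasurable _)]
  -- With the state frozen at `y` in region `j`, only the `j`-th noise vector enters. Hence
  -- dependence between the modes' noises at one time is harmless.
  refine lintegral_congr fun y => ?_
  obtain ⟨j, hj⟩ := S.exists_mem_region y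
  have hadd : Measurable fun z => S.closedLoopOp π j y + z := by fun_prop
  rw [S.kernel_apply π hj, ← h.law_noise t j, Measure.map_map hadd (h.measurable_noise t j),
    Measure.map_apply (hadd.comp (h.measurable_noise t j)) hs,
    Measure.map_apply hw (measurable_prodMk_left (S.measurable_stepMap π hs))]
  congr 1
  ext ω
  simp [S.stepMap_apply π hj]

lemma IsTrajectory.map_eq_bind_pow [IsProbabilityMeasure Pr] (h : S.IsTrajectory π Pr w x)
    (t : ℕ) : Pr.map (x t) =
      (Pr.map (x 0)).bind (S.kernel π ^ t : Kernel _ _) := by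
  induction t with
  | zero => rw [bind_pow_zero]
  | succ t ih => rw [bind_pow_succ', ← ih, h.map_succ]

end Trajectory

lemma weightedMetric_eq (β : ℝ≥0) :
    weightedMetric (n := n) β = weightedDiscrete (fun x => ‖x‖₊ ^ 2) β := by
  ext x y
  unfold weightedMetric weightedDiscrete
  split_ifs
  · rfl
  · have e : 2 + β * ‖x‖ ^ 2 + β * ‖y‖ ^ 2 = ((2 + β * ‖x‖₊ ^ 2 + β * ‖y‖₊ ^ 2 : ℝ≥0) : ℝ) := by
      simp
    rw [e, ENNReal.ofReal_coe_nnreal]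
    push_cast
    rfl

end SLDS

/-! ### Assembly of the ergodic theorem. -/

theorem theorem1 {n p M : ℕ} (S : SLDS n p M) (π : Matrix (Fin p) (Fin n) ℝ)
    (hstable : ∃ ϱ : ℝ, ∀ k : Fin M,
      (S.region k ∩ (Metric.closedBall 0 ϱ)ᶜ).Nonempty → ‖S.closedLoopOp π k‖ < 1) :
    ∃ ν : Measure (EuclideanSpace ℝ (Fin n)),
      -- `ν` is an ergodic invariant distribution, with finite second moment
      IsProbabilityMeasure ν ∧ IsErgodicInvariant (S.kernel π) ν ∧
      Integrable (fun x => ‖x‖ ^ 2) ν ∧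
      -- it is the only invariant distribution
      (∀ μ : Measure (EuclideanSpace ℝ (Fin n)), IsProbabilityMeasure μ →
        (S.kernel π).Invariant μ → μ = ν) ∧
      ∃ β C η : ℝ, 0 < β ∧ 0 < C ∧ 0 < η ∧ η < 1 ∧
        -- the transition kernel is a contraction in a Wasserstein metric
        (∀ μ₁ μ₂ : Measure (EuclideanSpace ℝ (Fin n)),
          IsProbabilityMeasure μ₁ → IsProbabilityMeasure μ₂ →
          wasserstein (weightedMetric β) (μ₁.bind (S.kernel π)) (μ₂.bind (S.kernel π)) ≤
            ENNReal.ofReal η * wasserstein (weightedMetric β) μ₁ μ₂) ∧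
        -- geometric convergence of the transition probabilities
        (∀ (x : EuclideanSpace ℝ (Fin n)) (t : ℕ),
          tvNorm ((S.kernel π ^ t) x) ν ≤ ENNReal.ofReal (C * η ^ t * (1 + ‖x‖ ^ 2))) ∧
        -- geometric convergence of the law of the state along every trajectory
        (∀ {Ω : Type*} [MeasurableSpace Ω] (Pr : Measure Ω) [IsProbabilityMeasure Pr]
          (w : ℕ → Fin M → Ω → EuclideanSpace ℝ (Fin n))
          (x : ℕ → Ω → EuclideanSpace ℝ (Fin n)),
          S.IsTrajectory π Pr w x → ∀ t : ℕ,
            tvNorm (Pr.map (x t)) ν ≤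
              ENNReal.ofReal (C * η ^ t) * (1 + ∫⁻ ω, ENNReal.ofReal (‖x 0 ω‖ ^ 2) ∂Pr)) := by
  open scoped NNReal in
  have hV : Measurable fun x : EuclideanSpace ℝ (Fin n) => ‖x‖₊ ^ 2 := by fun_prop
  obtain ⟨γ, K, hγ, hdrift⟩ := S.exists_drift π hstable
  obtain ⟨β, η, hβ0, hη0, hη1, hcontr⟩ := exists_wasserstein_contraction (S.kernel π) hV hγ hdrift
    (S.exists_smul_le_kernel π)
  obtain ⟨ν, hν, herg, hVν, huniq, hconv⟩ :=
    exists_invariant_of_contraction (S.kernel π) hV hγ hη1 hdrift hcontr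
  have hnorm : ∀ x : EuclideanSpace ℝ (Fin n),
      ENNReal.ofReal (‖x‖ ^ 2) = ((‖x‖₊ ^ 2 : NNReal) : ℝ≥0∞) := fun x => by
    rw [← ENNReal.ofReal_coe_nnreal]; simp
  obtain ⟨m, hm⟩ : ∃ m : NNReal, (m : ℝ≥0∞) = _ := ⟨_, ENNReal.coe_toNNReal hVν⟩
  rw [← hm] at hconv
  -- With `I` the second moment of `μ` and `m` that of `ν`, `2 + βI + βm ≤ (2 + β + βm)(1 + I)`;
  -- this yields `C = 2 + β + βm`.
  have hC : ∀ (t : ℕ) (μ : Measure (EuclideanSpace ℝ (Fin n))) [IsProbabilityMeasure μ],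
      tvNorm (μ.bind (S.kernel π ^ t : Kernel _ _)) ν ≤
        ENNReal.ofReal ((2 + β + β * m : NNReal) * η ^ t) *
          (1 + ∫⁻ x, (‖x‖₊ ^ 2 : NNReal) ∂μ) := fun t μ _ => by
    refine (hconv t μ).trans ?_
    rw [← NNReal.coe_pow, ← NNReal.coe_mul, ENNReal.ofReal_coe_nnreal]
    push_cast
    generalize ∫⁻ x, (‖x‖₊ : ℝ≥0∞) ^ 2 ∂μ = I
    calc (η : ℝ≥0∞) ^ t * (2 + β * I + β * m)
        ≤ (η : ℝ≥0∞) ^ t * (2 + β * I + β * m + (β + 2 * I + β * m * I)) := by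
          exact mul_le_mul_right le_self_add _
      _ = _ := by ring
  refine ⟨ν, hν, herg, ?_, huniq, β, (2 + β + β * m : NNReal), η, by exact_mod_cast hβ0, ?_,
    by exact_mod_cast hη0, by exact_mod_cast hη1, fun μ₁ μ₂ _ _ => ?_, fun x t => ?_, ?_⟩
  · refine ⟨by fun_prop, ?_⟩
    rw [hasFiniteIntegral_iff_ofReal (Filter.Eventually.of_forall fun x => by positivity)]
    simp_rw [hnorm]
    exact hVν.lt_top
  · have : (0 : NNReal) < 2 + β + β * m := by positivity
    exact_mod_cast this
  · rw [SLDS.weightedMetric_eq, ENNReal.ofReal_coe_nnreal]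
    exact hcontr μ₁ μ₂
  · have := hC t (Measure.dirac x)
    rw [Measure.dirac_bind (Kernel.measurable _), lintegral_dirac' _ (by fun_prop), ← hnorm] at this
    rwa [ENNReal.ofReal_mul (by positivity), ENNReal.ofReal_add one_pos.le (by positivity),
      ENNReal.ofReal_one]
  · intro Ω _ Pr _ w x hx t
    have := Measure.isProbabilityMeasure_map (μ := Pr) hx.measurable_init.aemeasurable
    have := hC t (Pr.map (x 0))
    rw [← hx.map_eq_bind_pow, lintegral_map (by fun_prop) hx.measurable_init] at this
    simpa only [hnorm] using this
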